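/- Let $n\ge 1$. **Definitions.** The 3-ary $n$-cube $Q_n^3$ is the graph on all tuples $(x_{n-1},\dots,x_0)\in\{0,1,2\}^n$ in which two tuples are adjacent if and only if they differ by $\pm1$ modulo $3$ in one coordinate and agree in all others. A caterpillar is a tree that becomes a path (the backbone) when all its leaves are deleted; it is 2-regular if every backbone vertex is adjacent to exactly two leaves. Let $2\text{-CAT}$ be the 2-regular caterpillar on $3^n$ vertices (so its backbone has $3^{n-1}$ vertices). An embedding $f$ of a graph $G$ into a graph $H$ is an injective map $f:V(G)\to V(H)$ together with, for each edge $uv$ of $G$, a path $P_f(uv)$ in $H$ between $f(u)$ and $f(v)$. Its wirelength is $WL_f(G,H)=\sum_{e\in E(H)}c_f(e)$, where $c_f(e)$ is the number of edges $uv$ of $G$ such that $e$ lies on $P_f(uv)$; and $WL(G,H)=\min_f WL_f(G,H)$ over all embeddings $f$ of $G$ into $H$. **Theorem.** Label the vertices of $Q_n^3$ by $0,1,\dots,3^n-1$ in lexicographic order, and label the vertices of $2\text{-CAT}$ by $0,1,\dots,3^n-1$ in preorder: each vertex is labelled when it is first visited by a depth-first traversal that starts at an end vertex of the backbone and, at each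 backbone vertex, visits its two leaves before it moves on to the next backbone vertex. Then the embedding $lex$ that maps each vertex of $Q_n^3$ to the vertex of $2\text{-CAT}$ with the same label (and each edge to the unique path between the images of its ends) has minimum wirelength, that is, $WL_{lex}(Q_n^3,2\text{-CAT})=WL(Q_n^3,2\text{-CAT})$, and $$WL(Q_n^3,2\text{-CAT})=2\cdot 3^{n-1}\left(3^{n-1}-1\right)+4n\cdot 3^{n-1}.$$ -/

import Mathlib

/-- The 3-ary `n`-cube: vertices are the `n`-tuples over `{0, 1, 2}`; two of them are adjacent iff
they differ by `±1` modulo 3 in one coordinate and agree in all the others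
(arithmetic in `Fin 3` is modulo 3). -/
def ternaryCube (n : ℕ) : SimpleGraph (Fin n → Fin 3) where
  Adj x y := ∃ j, (x j = y j + 1 ∨ x j = y j - 1) ∧ ∀ i, i ≠ j → x i = y i
  symm := ⟨by
    rintro x y ⟨j, h, hij⟩
    refine ⟨j, ?_, fun i hi => (hij i hi).symm⟩
    rcases h with h | h
    · right; rw [h, add_sub_cancel_right]
    · left; rw [h, sub_add_cancel]⟩
  loopless := ⟨by
    rintro x ⟨j, h, -⟩
    generalize x j = a at h
    revert a
    decide⟩

/-- Lexicographic order of the tuples `(x_{n-1}, …, x_0)`: the coordinate of largest index is the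
first, most significant, one. -/
def LexLT {n : ℕ} (x y : Fin n → Fin 3) : Prop :=
  ∃ i, (∀ j, i < j → x j = y j) ∧ x i < y i

/-- The label `0, 1, …, 3 ^ n - 1` of a tuple in the lexicographic order: the number of tuples
that precede it. -/
noncomputable def lexLabel {n : ℕ} (x : Fin n → Fin 3) : ℕ :=
  {y | LexLT y x}.ncard

/-- An embedding of `G` into `H`: an injective map `f` of the vertices and, for every edge `uv` of
`G`, a path of `H` between `f u` and `f v`. By `path_symm` the path belongs to the unordered edge.
Distinct edges automatically get distinct paths, as the end points differ. -/
structure GraphEmbedding {V W : Type*} (G : SimpleGraph V) (H : SimpleGraph W) where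
  toFun : V → W
  injective : Function.Injective toFun
  path : ∀ {u v : V}, G.Adj u v → H.Walk (toFun u) (toFun v)
  isPath : ∀ {u v : V} (h : G.Adj u v), (path h).IsPath
  path_symm : ∀ {u v : V} (h : G.Adj u v), path h.symm = (path h).reverse

/-- The congestion of an edge `e` of `H`: the number of edges of `G` whose path contains `e`. -/
noncomputable def GraphEmbedding.congestion {V W : Type*} {G : SimpleGraph V} {H : SimpleGraph W}
    (f : GraphEmbedding G H) (e : Sym2 W) : ℕ :=
  {d : Sym2 V | ∃ (u v : V) (h : G.Adj u v), d = s(u, v) ∧ e ∈ (f.path h).edges}.ncard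

open Classical in
/-- The wirelength of an embedding: the sum of the congestions of the edges of `H`. -/
noncomputable def GraphEmbedding.wirelength {V W : Type*} [Fintype W] {G : SimpleGraph V}
    {H : SimpleGraph W} (f : GraphEmbedding G H) : ℕ :=
  ∑ e ∈ H.edgeFinset, f.congestion e

/-- `WL(G, H)`: the minimum of the wirelength over all embeddings of `G` into `H`
(attained as soon as there is an embedding). -/
noncomputable def minWirelength {V W : Type*} [Fintype W] (G : SimpleGraph V)
    (H : SimpleGraph W) : ℕ :=
  sInf (Set.range fun f : GraphEmbedding G H => f.wirelength)

/-- A leaf: a vertex with exactly one neighbour. -/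
def IsLeaf {V : Type*} (H : SimpleGraph V) (v : V) : Prop :=
  (H.neighborSet v).ncard = 1

/-- The vertices that remain when all leaves are deleted. -/
def backbone {V : Type*} (H : SimpleGraph V) : Set V :=
  {v | ¬ IsLeaf H v}

/-- A caterpillar: a tree which becomes a path when all its leaves are deleted. -/
def IsCaterpillar {V : Type*} (H : SimpleGraph V) : Prop :=
  H.IsTree ∧ ∃ m, Nonempty (H.induce (backbone H) ≃g SimpleGraph.pathGraph m)

/-- A `k`-regular caterpillar: every backbone vertex carries exactly `k` leaves. -/
def IsRegularCaterpillar {V : Type*} (k : ℕ) (H : SimpleGraph V) : Prop :=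
  IsCaterpillar H ∧ ∀ v ∈ backbone H, {x | H.Adj v x ∧ IsLeaf H x}.ncard = k

/-- An end of the backbone: a backbone vertex with at most one neighbour in the backbone. -/
def IsBackboneEnd {V : Type*} (H : SimpleGraph V) (r : V) : Prop :=
  r ∈ backbone H ∧ {x | H.Adj r x ∧ x ∈ backbone H}.ncard ≤ 1

/-- `label` numbers the vertices of the tree `H` in the order of their first visit by a preorder
(depth first) traversal from the root `r`: `r` comes first, and each further vertex `w` is a
neighbour of the most recently visited vertex `p` that still has an unvisited neighbour, so that
all neighbours of the vertices visited after `p` and before `w` come before `w`. -/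
def IsPreorderLabelling {V : Type*} {N : ℕ} (H : SimpleGraph V) (r : V) (label : V ≃ Fin N) : Prop :=
  (label r : ℕ) = 0 ∧
  ∀ w, w ≠ r → ∃ p, H.Adj p w ∧ label p < label w ∧
    ∀ u, label p < label u → label u < label w → ∀ x, H.Adj u x → label x < label w

/-- A preorder labelling of a caterpillar: the traversal starts at an end of the backbone, and at
every backbone vertex `u` it visits the leaves `x` of `u` before it moves on to the next backbone
vertex `y`. -/
def IsCaterpillarPreorderLabelling {V : Type*} {N : ℕ} (H : SimpleGraph V) (label : V ≃ Fin N) : Prop :=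
  ∃ r, IsBackboneEnd H r ∧ IsPreorderLabelling H r label ∧
    ∀ u ∈ backbone H, ∀ y ∈ backbone H, ∀ x, IsLeaf H x →
      H.Adj u x → H.Adj u y → label u < label y → label x < label y

/-! In a tree, the path between two vertices uses an edge `e` iff the vertices lie on different
sides of `e`. Hence the congestion of `e` is the edge boundary, in the cube, of the preimage of one
side (`GraphEmbedding.congestion_eq_edgeBoundary`), and only the vertex map matters.

Cube and caterpillar have equally many vertices, so every embedding is a bijection. Each of the `2 *
3 ^ (n - 1)` leaf edges cuts off one vertex and has congestion `2 * n`, whatever the embedding. The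
`i`-th backbone edge (from 0) cuts off `3 * (i + 1)` vertices, so everything rests on the
edge-isoperimetric problem in the cube: lexicographic initial segments have the least boundary among
sets of their size (`le_edgeBoundary`). A preorder labelling numbers the sides of the backbone edges
by initial segments, so `lex` attains all these minima simultaneously.

By regularity, a least boundary means most inner edges. A tuple has as many lexicographically
earlier neighbours as its digit sum, so the first `k` tuples span `cumTernaryDigitSum k` edges. That
this is the maximum follows by slicing the cube into three layers (`innerDarts_le`), once
`cumTernaryDigitSum_superadd` is known. The value of the minimum comes from
`sum_cumTernaryDigitSum`. -/

/-! ### Base-3 digit sums -/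

/-- The sum of the base-3 digits. -/
def ternaryDigitSum (k : ℕ) : ℕ := (Nat.digits 3 k).sum

/-- The sum of the ternary digit sums of the numbers below `k`. -/
def cumTernaryDigitSum (k : ℕ) : ℕ := ∑ i ∈ Finset.range k, ternaryDigitSum i

theorem ternaryDigitSum_three_mul_add (k r : ℕ) (hr : r < 3) :
    ternaryDigitSum (3 * k + r) = ternaryDigitSum k + r := by
  rcases Nat.eq_zero_or_pos (3 * k + r) with h | h
  · obtain ⟨rfl, rfl⟩ : k = 0 ∧ r = 0 := by omega
    simp [ternaryDigitSum]
  · unfold ternaryDigitSum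
    rw [Nat.digits_def' (by norm_num) h, List.sum_cons]
    have h1 : (3 * k + r) % 3 = r := by omega
    have h2 : (3 * k + r) / 3 = k := by omega
    rw [h1, h2, add_comm]

/-- A carry replaces a digit 2 by 0, so it can only lower the digit sum. -/
theorem ternaryDigitSum_succ_le (k : ℕ) : ternaryDigitSum (k + 1) ≤ ternaryDigitSum k + 1 := by
  induction k using Nat.strong_induction_on with
  | _ k ih =>
    obtain ⟨q, r, hr, rfl⟩ : ∃ q r, r < 3 ∧ k = 3 * q + r :=
      ⟨k / 3, k % 3, Nat.mod_lt _ (by norm_num), by omega⟩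
    rw [ternaryDigitSum_three_mul_add q r hr]
    by_cases h2 : r = 2
    · subst h2
      have h3 : 3 * q + 2 + 1 = 3 * (q + 1) + 0 := by ring
      rw [h3, ternaryDigitSum_three_mul_add _ _ (by norm_num)]
      have := ih q (by omega)
      omega
    · rw [add_assoc, ternaryDigitSum_three_mul_add q (r + 1) (by omega)]
      omega

theorem cumTernaryDigitSum_zero : cumTernaryDigitSum 0 = 0 := rfl

theorem cumTernaryDigitSum_succ (k : ℕ) :
    cumTernaryDigitSum (k + 1) = cumTernaryDigitSum k + ternaryDigitSum k :=
  Finset.sum_range_succ _ _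

theorem cumTernaryDigitSum_three_mul (k : ℕ) :
    cumTernaryDigitSum (3 * k) = 3 * cumTernaryDigitSum k + 3 * k := by
  induction k with
  | zero => rfl
  | succ k ih =>
    have h0 := ternaryDigitSum_three_mul_add k 0 (by norm_num)
    have h1 := ternaryDigitSum_three_mul_add k 1 (by norm_num)
    have h2 := ternaryDigitSum_three_mul_add k 2 (by norm_num)
    rw [add_zero] at h0
    rw [show 3 * (k + 1) = 3 * k + 1 + 1 + 1 by ring]
    simp only [cumTernaryDigitSum_succ]
    rw [show 3 * k + 1 + 1 = 3 * k + 2 by ring]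
    omega

theorem cumTernaryDigitSum_three_mul_add_one (k : ℕ) :
    cumTernaryDigitSum (3 * k + 1) =
      3 * cumTernaryDigitSum k + 3 * k + ternaryDigitSum k := by
  have h0 := ternaryDigitSum_three_mul_add k 0 (by norm_num)
  rw [add_zero] at h0
  rw [cumTernaryDigitSum_succ, cumTernaryDigitSum_three_mul, h0]
  omega

theorem cumTernaryDigitSum_three_mul_add_two (k : ℕ) :
    cumTernaryDigitSum (3 * k + 2) =
      3 * cumTernaryDigitSum k + 3 * k + 2 * ternaryDigitSum k + 1 := by
  have h1 := ternaryDigitSum_three_mul_add k 1 (by norm_num)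
  rw [show 3 * k + 2 = 3 * k + 1 + 1 by ring, cumTernaryDigitSum_succ,
    cumTernaryDigitSum_three_mul_add_one, h1]
  omega

/-- Splitting the numbers below `k` by their last ternary digit. -/
theorem cumTernaryDigitSum_split (k : ℕ) :
    cumTernaryDigitSum k = cumTernaryDigitSum ((k + 2) / 3) + cumTernaryDigitSum ((k + 1) / 3) +
      cumTernaryDigitSum (k / 3) + (k + 1) / 3 + 2 * (k / 3) := by
  obtain ⟨q, r, hr, rfl⟩ : ∃ q r, r < 3 ∧ k = 3 * q + r :=
    ⟨k / 3, k % 3, Nat.mod_lt _ (by norm_num), by omega⟩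
  have hq : (3 * q + r) / 3 = q := by omega
  rw [hq]
  interval_cases r
  · rw [show (3 * q + 0 + 2) / 3 = q by omega, show (3 * q + 0 + 1) / 3 = q by omega, add_zero,
      cumTernaryDigitSum_three_mul]
    omega
  · rw [show (3 * q + 1 + 2) / 3 = q + 1 by omega, show (3 * q + 1 + 1) / 3 = q by omega,
      cumTernaryDigitSum_three_mul_add_one, cumTernaryDigitSum_succ]
    omega
  · rw [show (3 * q + 2 + 2) / 3 = q + 1 by omega, show (3 * q + 2 + 1) / 3 = q + 1 by omega,
      cumTernaryDigitSum_three_mul_add_two, cumTernaryDigitSum_succ]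
    omega

/-- The superadditivity property of `cumTernaryDigitSum` for a nearly balanced splitting. -/
theorem cumTernaryDigitSum_balanced (K p q : ℕ) (hqp : q ≤ p) (hp : p ≤ 3) :
    cumTernaryDigitSum (K + p) + cumTernaryDigitSum (K + q) + cumTernaryDigitSum K + (K + q) + 2 * K
      ≤ cumTernaryDigitSum (3 * K + (p + q)) := by
  have e0 := cumTernaryDigitSum_three_mul K
  have e1 := cumTernaryDigitSum_three_mul_add_one K
  have e2 := cumTernaryDigitSum_three_mul_add_two K
  have e3 := cumTernaryDigitSum_three_mul (K + 1)
  have e4 := cumTernaryDigitSum_three_mul_add_one (K + 1)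
  have e5 := cumTernaryDigitSum_three_mul_add_two (K + 1)
  have e6 := cumTernaryDigitSum_three_mul (K + 2)
  rw [show 3 * (K + 1) = 3 * K + 3 by ring] at e3 e4 e5
  rw [show 3 * (K + 2) = 3 * K + 6 by ring] at e6
  have s0 := cumTernaryDigitSum_succ K
  have s1 := cumTernaryDigitSum_succ (K + 1)
  have s2 := cumTernaryDigitSum_succ (K + 2)
  have l0 := ternaryDigitSum_succ_le K
  have l1 := ternaryDigitSum_succ_le (K + 1)
  simp only [add_assoc, Nat.reduceAdd] at *
  -- In each case both sides are linear in `cumTernaryDigitSum K` and the digit sums of `K`, `K +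
  -- 1`, `K + 2`; `l0` and `l1` bound the growth of the latter.
  interval_cases p <;> interval_cases q <;> simp only [Nat.reduceAdd, add_zero] <;> linarith

theorem third_add_third_add_third (a : ℕ) : (a + 2) / 3 + (a + 1) / 3 + a / 3 = a := by
  omega

theorem thirds_chain (a : ℕ) :
    a / 3 ≤ (a + 1) / 3 ∧ (a + 1) / 3 ≤ (a + 2) / 3 ∧ (a + 2) / 3 ≤ a / 3 + 1 := by
  omega

/-- The numerical inequality behind the edge-isoperimetric inequality of the ternary cube. -/
theorem cumTernaryDigitSum_superadd (a b c : ℕ) (hba : b ≤ a) (hcb : c ≤ b) :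
    cumTernaryDigitSum a + cumTernaryDigitSum b + cumTernaryDigitSum c + b + 2 * c
      ≤ cumTernaryDigitSum (a + b + c) := by
  induction ht : a + b + c using Nat.strong_induction_on generalizing a b c with
  | _ t ih =>
    subst ht
    -- The triples with `a ≤ 1` are separate because `(a + 2) / 3 < a` needs `2 ≤ a`.
    by_cases ha : a ≤ 1
    · have h1 : cumTernaryDigitSum 1 = 0 := by simp [cumTernaryDigitSum, ternaryDigitSum]
      have h2 : cumTernaryDigitSum 2 = 1 := by
        simp [cumTernaryDigitSum, ternaryDigitSum, Finset.sum_range_succ]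
      have h3 : cumTernaryDigitSum 3 = 3 := by
        simp [cumTernaryDigitSum, ternaryDigitSum, Finset.sum_range_succ]
      have h0 := cumTernaryDigitSum_zero
      clear ih
      obtain ⟨rfl, rfl, rfl⟩ | ⟨rfl, rfl, rfl⟩ | ⟨rfl, rfl, rfl⟩ | ⟨rfl, rfl, rfl⟩ :
          (a = 0 ∧ b = 0 ∧ c = 0) ∨ (a = 1 ∧ b = 0 ∧ c = 0) ∨ (a = 1 ∧ b = 1 ∧ c = 0) ∨
            (a = 1 ∧ b = 1 ∧ c = 1) := by omega
      all_goals simp [h0, h1, h2, h3]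
    · have ea := cumTernaryDigitSum_split a
      have eb := cumTernaryDigitSum_split b
      have ec := cumTernaryDigitSum_split c
      -- The numbers below `a`, `b`, `c` are split by last digit, and induction applies to the three
      -- counts belonging to each digit. The three resulting totals differ by at most 3, so
      -- `cumTernaryDigitSum_balanced` recombines them.
      have i0 := ih _ (by omega) ((a + 2) / 3) ((b + 2) / 3) ((c + 2) / 3)
        (by omega) (by omega) rfl
      have i1 := ih _ (by omega) ((a + 1) / 3) ((b + 1) / 3) ((c + 1) / 3)
        (by omega) (by omega) rfl
      have i2 := ih _ (by omega) (a / 3) (b / 3) (c / 3) (by omega) (by omega) rfl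
      have ta := third_add_third_add_third a
      have tb := third_add_third_add_third b
      have tc := third_add_third_add_third c
      obtain ⟨a1, a2, a3⟩ := thirds_chain a
      obtain ⟨b1, b2, b3⟩ := thirds_chain b
      obtain ⟨c1, c2, c3⟩ := thirds_chain c
      clear ih ha
      generalize (a + 2) / 3 = x0 at *
      generalize (a + 1) / 3 = x1 at *
      generalize a / 3 = x2 at *
      generalize (b + 2) / 3 = y0 at *
      generalize (b + 1) / 3 = y1 at *
      generalize b / 3 = y2 at *
      generalize (c + 2) / 3 = z0 at *
      generalize (c + 1) / 3 = z1 at *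
      generalize c / 3 = z2 at *
      obtain ⟨p, hp⟩ := Nat.exists_eq_add_of_le
        (show x2 + y2 + z2 ≤ x0 + y0 + z0 by linarith)
      obtain ⟨q, hq⟩ := Nat.exists_eq_add_of_le
        (show x2 + y2 + z2 ≤ x1 + y1 + z1 by linarith)
      have bal := cumTernaryDigitSum_balanced (x2 + y2 + z2) p q (by linarith) (by linarith)
      rw [show 3 * (x2 + y2 + z2) + (p + q) = a + b + c by linarith] at bal
      rw [hp] at i0
      rw [hq] at i1
      linarith

theorem cumTernaryDigitSum_pow (N : ℕ) : cumTernaryDigitSum (3 ^ N) = N * 3 ^ N := by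
  induction N with
  | zero => simp [cumTernaryDigitSum, ternaryDigitSum]
  | succ N ih => rw [pow_succ, mul_comm, cumTernaryDigitSum_three_mul, ih]; ring

theorem sum_range_three_mul (F : ℕ → ℕ) (k : ℕ) :
    ∑ i ∈ Finset.range (3 * k), F i =
      ∑ i ∈ Finset.range k, (F (3 * i) + F (3 * i + 1) + F (3 * i + 2)) := by
  induction k with
  | zero => rfl
  | succ k ih =>
    rw [show 3 * (k + 1) = 3 * k + 1 + 1 + 1 by ring]
    simp only [Finset.sum_range_succ, ih]
    ring

/-- A closed form with the negative terms moved across, to avoid natural subtraction. The induction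
groups the indices by residue modulo 3. -/
theorem sum_cumTernaryDigitSum (N : ℕ) :
    6 * ∑ i ∈ Finset.range (3 ^ N), cumTernaryDigitSum i + 2 * (3 ^ N) ^ 2 + 3 * N * 3 ^ N =
      3 * N * (3 ^ N) ^ 2 + 2 * 3 ^ N := by
  induction N with
  | zero => simp [cumTernaryDigitSum]
  | succ N ih =>
    have hid := Finset.sum_range_id_mul_two (3 ^ N)
    have hpow := cumTernaryDigitSum_pow N
    have hpos : 1 ≤ 3 ^ N := Nat.one_le_pow _ _ (by norm_num)
    obtain ⟨M, hM⟩ := Nat.exists_eq_add_of_le' hpos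
    rw [pow_succ, mul_comm (3 ^ N) 3, sum_range_three_mul]
    have key : ∑ i ∈ Finset.range (3 ^ N), (cumTernaryDigitSum (3 * i) +
        cumTernaryDigitSum (3 * i + 1) + cumTernaryDigitSum (3 * i + 2)) =
        9 * ∑ i ∈ Finset.range (3 ^ N), cumTernaryDigitSum i +
          9 * ∑ i ∈ Finset.range (3 ^ N), i + 3 * cumTernaryDigitSum (3 ^ N) + 3 ^ N := by
      rw [show cumTernaryDigitSum (3 ^ N) = ∑ i ∈ Finset.range (3 ^ N), ternaryDigitSum i from rfl]
      trans ∑ i ∈ Finset.range (3 ^ N),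
          (9 * cumTernaryDigitSum i + 9 * i + 3 * ternaryDigitSum i + 1)
      · refine Finset.sum_congr rfl fun i _ => ?_
        rw [cumTernaryDigitSum_three_mul, cumTernaryDigitSum_three_mul_add_one,
          cumTernaryDigitSum_three_mul_add_two]
        ring
      · simp [Finset.sum_add_distrib, Finset.mul_sum]
    rw [key, hpow]
    rw [hM, Nat.add_sub_cancel] at hid
    rw [hM] at ih ⊢
    nlinarith [ih, hid]

/-! ### Edge boundaries in the ternary cube -/

open Classical in
/-- The number of ordered pairs of adjacent vertices in a set of vertices of the ternary cube. -/
noncomputable def innerDarts {n : ℕ} (S : Finset (Fin n → Fin 3)) : ℕ :=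
  ∑ x ∈ S, ∑ y ∈ S, if (ternaryCube n).Adj x y then 1 else 0

/-- Modulo 3, differing by `±1` just means being different: the cube is a Hamming graph, a product
of triangles. -/
theorem ternaryCube_adj {n : ℕ} {x y : Fin n → Fin 3} :
    (ternaryCube n).Adj x y ↔ ∃ j, x j ≠ y j ∧ ∀ i, i ≠ j → x i = y i := by
  have key : ∀ a b : Fin 3, (a = b + 1 ∨ a = b - 1) ↔ a ≠ b := by decide
  simp only [ternaryCube, key]

theorem ternaryCube_adj_cons {n : ℕ} {a b : Fin 3} {x y : Fin n → Fin 3} :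
    (ternaryCube (n + 1)).Adj (Fin.cons a x) (Fin.cons b y) ↔
      (a ≠ b ∧ x = y) ∨ (a = b ∧ (ternaryCube n).Adj x y) := by
  simp only [ternaryCube_adj, Fin.exists_fin_succ, Fin.forall_fin_succ, Fin.cons_zero,
    Fin.cons_succ, ne_eq, not_true_eq_false, false_implies, true_and, Fin.succ_ne_zero,
    not_false_eq_true, true_implies, Fin.succ_inj, (Fin.succ_ne_zero _).symm, funext_iff]
  constructor
  · rintro (h | ⟨j, h1, h2, h3⟩)
    · exact Or.inl h
    · exact Or.inr ⟨h2, j, h1, h3⟩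
  · rintro (h | ⟨h2, j, h1, h3⟩)
    · exact Or.inl h
    · exact Or.inr ⟨j, h1, h2, h3⟩

/-- The part of `S` in the layer where the coordinate of index 0 is `a`. -/
def cubeSlice {n : ℕ} (S : Finset (Fin (n + 1) → Fin 3)) (a : Fin 3) : Finset (Fin n → Fin 3) :=
  Finset.univ.filter fun x => (Fin.cons a x : Fin (n + 1) → Fin 3) ∈ S

theorem sum_cubeSlice {n : ℕ} (S : Finset (Fin (n + 1) → Fin 3))
    (F : (Fin (n + 1) → Fin 3) → ℕ) :
    ∑ x ∈ S, F x = ∑ a, ∑ x ∈ cubeSlice S a, F (Fin.cons a x) := by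
  simp only [cubeSlice, Finset.sum_filter]
  rw [← Fintype.sum_prod_type' (f := fun (a : Fin 3) (x : Fin n → Fin 3) =>
    if (Fin.cons a x : Fin (n + 1) → Fin 3) ∈ S then F (Fin.cons a x) else 0)]
  rw [← Equiv.sum_comp (Fin.consEquiv fun _ => Fin 3).symm]
  simp only [Fin.consEquiv_symm_apply, Fin.cons_self_tail]
  rw [← Finset.sum_filter, Finset.filter_univ_mem]

theorem card_cubeSlice {n : ℕ} (S : Finset (Fin (n + 1) → Fin 3)) :
    S.card = (cubeSlice S 0).card + (cubeSlice S 1).card + (cubeSlice S 2).card := by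
  rw [Finset.card_eq_sum_ones, sum_cubeSlice]
  simp [Fin.sum_univ_three]

/-- Two distinct layers are joined by a perfect matching, so the edges of `S` between them
correspond to the intersection of the slices. -/
theorem innerDarts_cubeSlice {n : ℕ} (S : Finset (Fin (n + 1) → Fin 3)) :
    innerDarts S = innerDarts (cubeSlice S 0) + innerDarts (cubeSlice S 1) +
      innerDarts (cubeSlice S 2) + 2 * ((cubeSlice S 0 ∩ cubeSlice S 1).card +
      (cubeSlice S 0 ∩ cubeSlice S 2).card + (cubeSlice S 1 ∩ cubeSlice S 2).card) := by
  classical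
  have same (a : Fin 3) : (∑ x ∈ cubeSlice S a, ∑ y ∈ cubeSlice S a,
      if (ternaryCube (n + 1)).Adj (Fin.cons a x) (Fin.cons a y) then 1 else 0) =
      innerDarts (cubeSlice S a) := by
    simp [innerDarts, ternaryCube_adj_cons]
  have diff (a b : Fin 3) (h : a ≠ b) : (∑ x ∈ cubeSlice S a, ∑ y ∈ cubeSlice S b,
      if (ternaryCube (n + 1)).Adj (Fin.cons a x) (Fin.cons b y) then 1 else 0) =
      (cubeSlice S a ∩ cubeSlice S b).card := by
    simp [ternaryCube_adj_cons, h]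
  unfold innerDarts
  rw [sum_cubeSlice]
  simp only [sum_cubeSlice S, Fin.sum_univ_three, Finset.sum_add_distrib]
  rw [same, same, same, diff 0 1 (by decide), diff 0 2 (by decide), diff 1 0 (by decide),
    diff 1 2 (by decide), diff 2 0 (by decide), diff 2 1 (by decide),
    Finset.inter_comm (cubeSlice S 1) (cubeSlice S 0),
    Finset.inter_comm (cubeSlice S 2) (cubeSlice S 0),
    Finset.inter_comm (cubeSlice S 2) (cubeSlice S 1)]
  unfold innerDarts
  ring

/-- The edge-isoperimetric inequality of the ternary cube: an upper bound on the number of edges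
inside a set of given size. -/
theorem innerDarts_le {n : ℕ} (S : Finset (Fin n → Fin 3)) :
    innerDarts S ≤ 2 * cumTernaryDigitSum S.card := by
  induction n with
  | zero =>
    have : innerDarts S = 0 := by
      simp [innerDarts, ternaryCube_adj]
    omega
  | succ n ih =>
    rw [innerDarts_cubeSlice, card_cubeSlice]
    have i0 := ih (cubeSlice S 0)
    have i1 := ih (cubeSlice S 1)
    have i2 := ih (cubeSlice S 2)
    have l01 := Finset.card_le_card
      (Finset.inter_subset_left (s₁ := cubeSlice S 0) (s₂ := cubeSlice S 1))
    have r01 := Finset.card_le_card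
      (Finset.inter_subset_right (s₁ := cubeSlice S 0) (s₂ := cubeSlice S 1))
    have l02 := Finset.card_le_card
      (Finset.inter_subset_left (s₁ := cubeSlice S 0) (s₂ := cubeSlice S 2))
    have r02 := Finset.card_le_card
      (Finset.inter_subset_right (s₁ := cubeSlice S 0) (s₂ := cubeSlice S 2))
    have l12 := Finset.card_le_card
      (Finset.inter_subset_left (s₁ := cubeSlice S 1) (s₂ := cubeSlice S 2))
    have r12 := Finset.card_le_card
      (Finset.inter_subset_right (s₁ := cubeSlice S 1) (s₂ := cubeSlice S 2))
    generalize (cubeSlice S 0 ∩ cubeSlice S 1).card = p at *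
    generalize (cubeSlice S 0 ∩ cubeSlice S 2).card = q at *
    generalize (cubeSlice S 1 ∩ cubeSlice S 2).card = r at *
    generalize (cubeSlice S 0).card = a at *
    generalize (cubeSlice S 1).card = b at *
    generalize (cubeSlice S 2).card = c at *
    -- Each intersection is at most the smaller slice. With the sizes sorted as `a ≥ b ≥ c` the
    -- bounds add up to `b + 2 * c`, the extra term in `cumTernaryDigitSum_superadd`.
    rcases le_total a b with hab | hab <;> rcases le_total b c with hbc | hbc <;>
      rcases le_total a c with hac | hac
    · have := cumTernaryDigitSum_superadd c b a hbc hab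
      rw [show c + b + a = a + b + c by ring] at this
      linarith
    · have := cumTernaryDigitSum_superadd c b a hbc hab
      rw [show c + b + a = a + b + c by ring] at this
      linarith
    · have := cumTernaryDigitSum_superadd b c a hbc hac
      rw [show b + c + a = a + b + c by ring] at this
      linarith
    · have := cumTernaryDigitSum_superadd b a c hab hac
      rw [show b + a + c = a + b + c by ring] at this
      linarith
    · have := cumTernaryDigitSum_superadd c a b hac hab
      rw [show c + a + b = a + b + c by ring] at this
      linarith
    · have := cumTernaryDigitSum_superadd a c b hac hbc
      rw [show a + c + b = a + b + c by ring] at this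
      linarith
    · have := cumTernaryDigitSum_superadd a b c hab hbc
      linarith
    · have := cumTernaryDigitSum_superadd a b c hab hbc
      linarith

/-! ### Lexicographic segments -/

theorem finFunctionFinEquiv_cons {n : ℕ} (a : Fin 3) (x : Fin n → Fin 3) :
    (finFunctionFinEquiv (Fin.cons a x : Fin (n + 1) → Fin 3) : ℕ) =
      a + 3 * (finFunctionFinEquiv x : ℕ) := by
  simp only [finFunctionFinEquiv_apply, Fin.sum_univ_succ, Fin.cons_zero, Fin.cons_succ,
    Fin.val_zero, pow_zero, mul_one, Fin.val_succ, Finset.mul_sum]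
  congr 1
  exact Finset.sum_congr rfl fun i _ => by ring

/-- `finFunctionFinEquiv` reads the coordinate of index 0 as the units digit, which is also the
least significant one for `LexLT`; the induction peels it off. -/
theorem lexLT_iff {n : ℕ} (x y : Fin n → Fin 3) :
    LexLT x y ↔ finFunctionFinEquiv x < finFunctionFinEquiv y := by
  induction n with
  | zero =>
    simp [LexLT, Subsingleton.elim x y]
  | succ n ih =>
    obtain ⟨a, x, rfl⟩ : ∃ a z, x = Fin.cons a z := ⟨_, _, (Fin.cons_self_tail x).symm⟩
    obtain ⟨b, y, rfl⟩ : ∃ a z, y = Fin.cons a z := ⟨_, _, (Fin.cons_self_tail y).symm⟩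
    have h := ih x y
    rw [Fin.lt_def] at h ⊢
    rw [finFunctionFinEquiv_cons, finFunctionFinEquiv_cons]
    have hcons : LexLT (Fin.cons a x : Fin (n + 1) → Fin 3) (Fin.cons b y) ↔
        LexLT x y ∨ (x = y ∧ a < b) := by
      simp only [LexLT, Fin.exists_fin_succ, Fin.forall_fin_succ, Fin.cons_zero,
        Fin.cons_succ, Fin.succ_lt_succ_iff, Fin.succ_pos, false_implies,
        true_implies, true_and, not_lt_zero, funext_iff]
      exact or_comm
    have hxy : x = y ↔ (finFunctionFinEquiv x : ℕ) = finFunctionFinEquiv y := by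
      rw [← Fin.ext_iff, EmbeddingLike.apply_eq_iff_eq]
    rw [hcons, h, hxy, Fin.lt_def]
    omega

theorem lexLabel_eq {n : ℕ} (x : Fin n → Fin 3) : lexLabel x = finFunctionFinEquiv x := by
  unfold lexLabel
  simp only [lexLT_iff]
  have : {y : Fin n → Fin 3 | finFunctionFinEquiv y < finFunctionFinEquiv x} =
      finFunctionFinEquiv ⁻¹' (↑(Finset.Iio (finFunctionFinEquiv x)) : Set (Fin (3 ^ n))) := by
    ext; simp
  rw [this, Set.ncard_preimage_of_injective_subset_range finFunctionFinEquiv.injective (by simp),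
    Set.ncard_coe_finset, Fin.card_Iio]

/-- The first `k` tuples in the lexicographic order. -/
def lexSegment (n k : ℕ) : Finset (Fin n → Fin 3) :=
  Finset.univ.filter fun x => (finFunctionFinEquiv x : ℕ) < k

theorem card_lexSegment {n k : ℕ} (hk : k ≤ 3 ^ n) : (lexSegment n k).card = k := by
  rw [lexSegment, Finset.card_equiv finFunctionFinEquiv
    (t := Finset.univ.filter fun i : Fin (3 ^ n) => (i : ℕ) < k) (by simp)]
  rw [Fin.card_filter_val_lt]
  omega

theorem cubeSlice_lexSegment (n k : ℕ) (a : Fin 3) :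
    cubeSlice (lexSegment (n + 1) k) a = lexSegment n ((k + 2 - a) / 3) := by
  ext x
  simp only [cubeSlice, lexSegment, Finset.mem_filter, Finset.mem_univ, true_and,
    finFunctionFinEquiv_cons]
  omega

theorem lexSegment_mono (n : ℕ) {k l : ℕ} (h : k ≤ l) : lexSegment n k ⊆ lexSegment n l := by
  intro x
  simp only [lexSegment, Finset.mem_filter, Finset.mem_univ, true_and]
  omega

/-- The slices of a segment are nested segments, so the intersections are as large as possible, and
the count obeys the recursion `cumTernaryDigitSum_split`. -/
theorem innerDarts_lexSegment {n k : ℕ} (hk : k ≤ 3 ^ n) :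
    innerDarts (lexSegment n k) = 2 * cumTernaryDigitSum k := by
  induction n generalizing k with
  | zero =>
    have h0 : innerDarts (lexSegment 0 k) = 0 := by
      simp [innerDarts, ternaryCube_adj]
    rw [pow_zero] at hk
    interval_cases k <;> simp [h0, cumTernaryDigitSum, ternaryDigitSum]
  | succ n ih =>
    rw [pow_succ] at hk
    obtain ⟨c1, c2, -⟩ := thirds_chain k
    rw [innerDarts_cubeSlice]
    simp only [cubeSlice_lexSegment, Fin.val_zero, Fin.val_one, Fin.val_two, Nat.sub_zero,
      Nat.add_sub_cancel, show k + 2 - 1 = k + 1 by omega]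
    rw [Finset.inter_eq_right.2 (lexSegment_mono n c2), Finset.inter_eq_right.2 (lexSegment_mono n c1),
      Finset.inter_eq_right.2 (lexSegment_mono n (c1.trans c2)), card_lexSegment (by omega),
      card_lexSegment (by omega), ih (by omega), ih (by omega), ih (by omega),
      cumTernaryDigitSum_split k]
    ring

theorem degree_ternaryCube {n : ℕ} (x : Fin n → Fin 3) [∀ y, Decidable ((ternaryCube n).Adj x y)] :
    ∑ y, (if (ternaryCube n).Adj x y then 1 else 0) = 2 * n := by
  classical
  induction n with
  | zero => simp [ternaryCube_adj]
  | succ n ih =>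
    obtain ⟨a, x, rfl⟩ : ∃ a z, x = Fin.cons a z := ⟨_, _, (Fin.cons_self_tail x).symm⟩
    rw [sum_cubeSlice]
    have huniv (b : Fin 3) : cubeSlice (Finset.univ : Finset (Fin (n + 1) → Fin 3)) b =
        Finset.univ := by
      simp [cubeSlice]
    -- The layer of the vertex contributes `2 * n` neighbours, each of the other two layers one.
    have hfin : ∀ a : Fin 3, ∑ b : Fin 3, (if a = b then 2 * n else 1) = 2 * (n + 1) := by
      intro a
      fin_cases a <;> simp [Fin.sum_univ_three] <;> ring
    rw [← hfin a]
    refine Finset.sum_congr rfl fun b _ => ?_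
    rw [huniv]
    by_cases h : a = b
    · simp only [ternaryCube_adj_cons, h, ne_eq, not_true_eq_false, false_and, false_or, true_and,
        if_true]
      convert ih x
    · simp [ternaryCube_adj_cons, h]

/-! ### Edge boundaries and their sum over lexicographic segments -/

/-- The number of edges between `S` and its complement. -/
noncomputable def edgeBoundary {V : Type*} (G : SimpleGraph V) (S : Set V) : ℕ :=
  {d : Sym2 V | ∃ u v, G.Adj u v ∧ d = s(u, v) ∧ u ∈ S ∧ v ∉ S}.ncard

/-- The degrees over `S` are summed: a boundary edge counts once, an inner edge twice. -/
theorem edgeBoundary_add_innerDarts {n : ℕ} (S : Finset (Fin n → Fin 3)) :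
    edgeBoundary (ternaryCube n) ↑S + innerDarts S = 2 * n * S.card := by
  classical
  have hb : edgeBoundary (ternaryCube n) (↑S : Set (Fin n → Fin 3)) =
      ∑ x ∈ S, ∑ y ∈ Sᶜ, if (ternaryCube n).Adj x y then 1 else 0 := by
    have himg : {d : Sym2 (Fin n → Fin 3) | ∃ u v, (ternaryCube n).Adj u v ∧ d = s(u, v) ∧
        u ∈ (↑S : Set (Fin n → Fin 3)) ∧ v ∉ (↑S : Set (Fin n → Fin 3))} =
        ↑(((S ×ˢ Sᶜ).filter fun p => (ternaryCube n).Adj p.1 p.2).image fun p => s(p.1, p.2)) := by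
      ext d
      simp only [Set.mem_ofPred_eq, Finset.coe_image, Set.mem_image, Finset.mem_coe,
        Finset.mem_filter, Finset.mem_product, Finset.mem_compl, Prod.exists]
      constructor
      · rintro ⟨u, v, h, rfl, hu, hv⟩
        exact ⟨u, v, ⟨⟨hu, hv⟩, h⟩, rfl⟩
      · rintro ⟨u, v, ⟨⟨hu, hv⟩, h⟩, rfl⟩
        exact ⟨u, v, h, rfl, hu, hv⟩
    rw [edgeBoundary, himg, Set.ncard_coe_finset, Finset.card_image_of_injOn, Finset.card_filter,
      Finset.sum_product]
    rintro ⟨u, v⟩ h ⟨u', v'⟩ h' he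
    simp only [Finset.coe_filter, Finset.mem_product, Finset.mem_compl, Set.mem_ofPred_eq] at h h'
    rcases Sym2.eq_iff.1 he with ⟨rfl, rfl⟩ | ⟨rfl, rfl⟩
    · rfl
    · exact absurd h.1.1 h'.1.2
  rw [hb, innerDarts, ← Finset.sum_add_distrib]
  simp only [Finset.sum_compl_add_sum, degree_ternaryCube]
  simp [mul_comm]

theorem le_edgeBoundary {n : ℕ} (S : Finset (Fin n → Fin 3)) :
    edgeBoundary (ternaryCube n) ↑(lexSegment n S.card) ≤ edgeBoundary (ternaryCube n) ↑S := by
  have hk : S.card ≤ 3 ^ n := by simpa using Finset.card_le_univ S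
  have h1 := edgeBoundary_add_innerDarts S
  have h2 := edgeBoundary_add_innerDarts (lexSegment n S.card)
  have h3 := innerDarts_le S
  rw [card_lexSegment hk, innerDarts_lexSegment hk] at h2
  omega

theorem edgeBoundary_singleton {n : ℕ} (x : Fin n → Fin 3) :
    edgeBoundary (ternaryCube n) {x} = 2 * n := by
  have h := edgeBoundary_add_innerDarts {x}
  simpa [innerDarts, Finset.filter_singleton] using h

/-- The total edge boundary of the lexicographic segments whose sizes are multiples of three. -/
theorem sum_edgeBoundary_lexSegment (N : ℕ) :
    ∑ i ∈ Finset.range (3 ^ N - 1),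
      edgeBoundary (ternaryCube (N + 1)) ↑(lexSegment (N + 1) (3 * (i + 1))) =
        2 * 3 ^ N * (3 ^ N - 1) := by
  have hterm (i : ℕ) (hi : i < 3 ^ N) :
      edgeBoundary (ternaryCube (N + 1)) ↑(lexSegment (N + 1) (3 * i)) +
        6 * cumTernaryDigitSum i = 6 * N * i := by
    have hk : 3 * i ≤ 3 ^ (N + 1) := by rw [pow_succ]; omega
    have h := edgeBoundary_add_innerDarts (lexSegment (N + 1) (3 * i))
    rw [card_lexSegment hk, innerDarts_lexSegment hk, cumTernaryDigitSum_three_mul] at h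
    linarith
  have hpos : 1 ≤ 3 ^ N := Nat.one_le_pow _ _ (by norm_num)
  obtain ⟨M, hM⟩ := Nat.exists_eq_add_of_le' hpos
  have hsum := Finset.sum_congr rfl fun i hi => hterm i (Finset.mem_range.1 hi)
  have h0 := hterm 0 hpos
  simp only [mul_zero] at h0
  have hid := Finset.sum_range_id_mul_two (3 ^ N)
  have hs := sum_cumTernaryDigitSum N
  rw [Finset.sum_add_distrib, ← Finset.mul_sum, ← Finset.mul_sum] at hsum
  rw [hM] at hsum hid hs ⊢
  -- The term split off belongs to the empty segment; its boundary vanishes by `h0`.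
  rw [Finset.sum_range_succ' (fun i => edgeBoundary _ _), mul_zero] at hsum
  rw [Nat.add_sub_cancel] at hid ⊢
  nlinarith

/-! ### Congestion across a cut -/

/-- By `hcut`, `e` is the only edge across the cut, so every passage along it switches sides and no
other step does. -/
theorem SimpleGraph.Walk.odd_count_edges_iff {V : Type*} [DecidableEq V] {H : SimpleGraph V}
    {S : Set V} {e : Sym2 V}
    (hcut : ∀ u v, H.Adj u v → (s(u, v) = e ↔ ¬(u ∈ S ↔ v ∈ S))) {a b : V} (p : H.Walk a b) :
    Odd (p.edges.count e) ↔ ¬(a ∈ S ↔ b ∈ S) := by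
  induction p with
  | nil => simp
  | @cons u v w h p ih =>
    have hc := hcut u v h
    rw [SimpleGraph.Walk.edges_cons]
    by_cases he : s(u, v) = e
    · subst he
      rw [List.count_cons_self, Nat.odd_add_one, ih]
      have := hc.1 rfl
      tauto
    · rw [List.count_cons_of_ne he, ih]
      tauto

theorem SimpleGraph.Walk.IsPath.mem_edges_iff_of_cut {V : Type*} {H : SimpleGraph V}
    {S : Set V} {e : Sym2 V}
    (hcut : ∀ u v, H.Adj u v → (s(u, v) = e ↔ ¬(u ∈ S ↔ v ∈ S))) {a b : V} {p : H.Walk a b}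
    (hp : p.IsPath) : e ∈ p.edges ↔ ¬(a ∈ S ↔ b ∈ S) := by
  classical
  rw [← p.odd_count_edges_iff hcut, ← List.count_pos_iff]
  have h := List.nodup_iff_count_le_one.1 hp.isTrail.edges_nodup e
  generalize p.edges.count e = c at *
  interval_cases c <;> simp

theorem GraphEmbedding.congestion_eq_edgeBoundary {V W : Type*} {G : SimpleGraph V}
    {H : SimpleGraph W} (f : GraphEmbedding G H) {S : Set W} {e : Sym2 W}
    (hcut : ∀ u v, H.Adj u v → (s(u, v) = e ↔ ¬(u ∈ S ↔ v ∈ S))) :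
    f.congestion e = edgeBoundary G (f.toFun ⁻¹' S) := by
  unfold GraphEmbedding.congestion edgeBoundary
  congr 1
  ext d
  simp only [Set.mem_ofPred_eq, Set.mem_preimage]
  constructor
  · rintro ⟨u, v, h, rfl, he⟩
    rw [(f.isPath h).mem_edges_iff_of_cut hcut] at he
    by_cases hu : f.toFun u ∈ S
    · exact ⟨u, v, h, rfl, hu, by tauto⟩
    · exact ⟨v, u, h.symm, Sym2.eq_swap, by tauto, hu⟩
  · rintro ⟨u, v, h, rfl, hu, hv⟩
    exact ⟨u, v, h, rfl, ((f.isPath h).mem_edges_iff_of_cut hcut).2 (by tauto)⟩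

theorem SimpleGraph.IsTree.exists_graphEmbedding {V W : Type*} (G : SimpleGraph V)
    {H : SimpleGraph W} (hH : H.IsTree) (g : V → W) (hg : Function.Injective g) :
    ∃ f : GraphEmbedding G H, f.toFun = g := by
  have hex := fun u v => (hH.existsUnique_path u v).exists
  choose p hp using hex
  exact ⟨⟨g, hg, fun {u v} _ => p (g u) (g v), fun _ => hp _ _,
    fun {u v} _ => (hH.existsUnique_path (g v) (g u)).unique (hp _ _) (hp _ _).reverse⟩, rfl⟩

/-! ### The structure of a 2-regular caterpillar -/

/-- `b` enumerates the backbone of the 2-regular caterpillar `H` along the path that it forms, and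
`σ` maps each vertex to the position of the backbone vertex that it is or hangs on. -/
structure IsSpine {V : Type*} [Fintype V] (H : SimpleGraph V) {k : ℕ} (b : Fin (k + 1) → V)
    (σ : V → Fin (k + 1)) : Prop where
  idx (i) : σ (b i) = i
  adj_spine (i j) : H.Adj (b i) (b j) ↔ (i : ℕ) + 1 = j ∨ (j : ℕ) + 1 = i
  adj_leaf (x) : b (σ x) ≠ x → ∀ y, H.Adj x y ↔ y = b (σ x)
  isLeaf_iff (x) : IsLeaf H x ↔ b (σ x) ≠ x
  card_fiber (i) : (Finset.univ.filter fun x => σ x = i).card = 3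

/-- Two adjacent leaves would form a whole component, hence the whole graph. -/
theorem exists_backbone_neighbor {V : Type*} [Fintype V] {H : SimpleGraph V} (hH : H.Connected)
    (hcard : 3 ≤ Fintype.card V) {x : V} (hx : IsLeaf H x) :
    ∃ y ∈ backbone H, ∀ z, H.Adj x z ↔ z = y := by
  classical
  obtain ⟨y, hy⟩ := Set.ncard_eq_one.1 hx
  have hxy : ∀ z, H.Adj x z ↔ z = y := fun z => by
    rw [← SimpleGraph.mem_neighborSet, hy, Set.mem_singleton_iff]
  refine ⟨y, fun hleaf => ?_, hxy⟩
  obtain ⟨x', hx'⟩ := Set.ncard_eq_one.1 hleaf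
  have hyx : ∀ z, H.Adj y z ↔ z = x' := fun z => by
    rw [← SimpleGraph.mem_neighborSet, hx', Set.mem_singleton_iff]
  obtain rfl : x = x' := (hyx x).1 ((hxy y).2 rfl).symm
  have hall : ∀ z, z = x ∨ z = y := by
    intro z
    obtain ⟨p⟩ := hH.preconnected z x
    induction p with
    | nil => exact Or.inl rfl
    | cons h p ih =>
      rcases ih hx hy hxy hx' hyx with rfl | rfl
      · exact Or.inr ((hxy _).1 h.symm)
      · exact Or.inl ((hyx _).1 h.symm)
  have : (Finset.univ : Finset V) ⊆ {x, y} := fun z _ => by simpa using hall z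
  have := (Finset.card_le_card this).trans Finset.card_le_two
  rw [Finset.card_univ] at this
  omega

theorem IsRegularCaterpillar.exists_isSpine {V : Type*} [Fintype V] {H : SimpleGraph V}
    (hH : IsRegularCaterpillar 2 H) (hcard : 3 ≤ Fintype.card V) :
    ∃ (k : ℕ) (b : Fin (k + 1) → V) (σ : V → Fin (k + 1)), IsSpine H b σ := by
  classical
  obtain ⟨⟨htree, m, ⟨e⟩⟩, hreg⟩ := hH
  have hρ : ∀ x, ∃ p : backbone H, (x ∈ backbone H → (p : V) = x) ∧
      (IsLeaf H x → ∀ z, H.Adj x z ↔ z = p) := by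
    intro x
    by_cases hx : IsLeaf H x
    · obtain ⟨y, hy, h⟩ := exists_backbone_neighbor htree.1 hcard hx
      exact ⟨⟨y, hy⟩, fun h' => absurd hx h', fun _ => h⟩
    · exact ⟨⟨x, hx⟩, fun _ => rfl, fun h => absurd h hx⟩
  choose ρ hρb hρl using hρ
  obtain ⟨v⟩ := htree.1.nonempty
  obtain ⟨k, rfl⟩ : ∃ k, m = k + 1 :=
    Nat.exists_eq_succ_of_ne_zero fun h => by subst h; exact (e (ρ v)).elim0
  have hbσ : ∀ x, ((e.symm (e (ρ x)) : backbone H) : V) = ρ x := fun x => by simp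
  have hleaf : ∀ x, IsLeaf H x ↔ (ρ x : V) ≠ x := by
    refine fun x => ⟨fun hx h => ?_, fun h => by_contra fun hx => h (hρb x hx)⟩
    have := (ρ x).2
    rw [h] at this
    exact this hx
  have hidx : ∀ i, e (ρ (e.symm i : backbone H)) = i := fun i => by
    have : ρ (e.symm i : backbone H) = e.symm i := Subtype.ext (hρb _ (e.symm i).2)
    rw [this, e.apply_symm_apply]
  refine ⟨k, fun i => (e.symm i : backbone H), fun x => e (ρ x), hidx, fun i j => ?_,
    fun x hx y => ?_, fun x => ?_, fun i => ?_⟩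
  · rw [← SimpleGraph.pathGraph_adj, ← e.symm.map_adj_iff, SimpleGraph.comap_adj]
    rfl
  · rw [hbσ] at hx ⊢
    exact hρl x ((hleaf x).2 hx) y
  · rw [hbσ, hleaf]
  · have h2 := hreg _ (e.symm i).2
    have hset : (↑(Finset.univ.filter fun x => e (ρ x) = i) : Set V) =
        insert ((e.symm i : backbone H) : V)
          {x | H.Adj (e.symm i : backbone H) x ∧ IsLeaf H x} := by
      ext x
      simp only [Finset.coe_filter, Finset.mem_univ, true_and, Set.mem_ofPred_eq,
        Set.mem_insert_iff]
      constructor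
      · rintro rfl
        rw [hbσ]
        by_cases hx : IsLeaf H x
        · exact Or.inr ⟨((hρl x hx _).2 rfl).symm, hx⟩
        · exact Or.inl (hρb x hx).symm
      · rintro (rfl | ⟨hadj, hx⟩)
        · exact hidx i
        · rw [← e.apply_symm_apply i]
          exact congrArg e (Subtype.ext ((hρl x hx _).1 hadj.symm).symm)
    rw [← Set.ncard_coe_finset, hset, Set.ncard_insert_of_notMem, h2]
    exact fun h => H.irrefl h.1

/-! ### Cuts, sizes and labels along the spine -/

namespace IsSpine

variable {V : Type*} [Fintype V] {H : SimpleGraph V} {k : ℕ} {b : Fin (k + 1) → V}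
  {σ : V → Fin (k + 1)}

theorem injective (hs : IsSpine H b σ) : Function.Injective b := fun i j h => by
  rw [← hs.idx i, h, hs.idx]

theorem mem_backbone_iff (hs : IsSpine H b σ) {x : V} : x ∈ backbone H ↔ b (σ x) = x := by
  rw [backbone, Set.mem_ofPred_eq, hs.isLeaf_iff, not_not]

theorem spine_mem_backbone (hs : IsSpine H b σ) (i : Fin (k + 1)) : b i ∈ backbone H := by
  rw [hs.mem_backbone_iff, hs.idx]

theorem adj_spine_succ (hs : IsSpine H b σ) (i : Fin k) : H.Adj (b i.castSucc) (b i.succ) := by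
  rw [hs.adj_spine]; simp

theorem adj_cases (hs : IsSpine H b σ) {x y : V} (h : H.Adj x y) :
    (b (σ x) ≠ x ∧ y = b (σ x)) ∨ (b (σ y) ≠ y ∧ x = b (σ y)) ∨
      ∃ i : Fin k, (x = b i.castSucc ∧ y = b i.succ) ∨ (x = b i.succ ∧ y = b i.castSucc) := by
  by_cases hx : b (σ x) = x
  · by_cases hy : b (σ y) = y
    · right; right
      have h' := h
      rw [← hx, ← hy, hs.adj_spine] at h'
      rcases h' with h' | h'
      · have hlt : (σ x : ℕ) < k := by have := (σ y).2; omega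
        refine ⟨⟨σ x, hlt⟩, Or.inl ⟨hx.symm, hy.symm.trans (congrArg b (Fin.ext ?_))⟩⟩
        simp [← h']
      · have hlt : (σ y : ℕ) < k := by have := (σ x).2; omega
        refine ⟨⟨σ y, hlt⟩, Or.inr ⟨hx.symm.trans (congrArg b (Fin.ext ?_)), hy.symm⟩⟩
        simp [← h']
    · exact Or.inr (Or.inl ⟨hy, (hs.adj_leaf y hy x).1 h.symm⟩)
  · exact Or.inl ⟨hx, (hs.adj_leaf x hx y).1 h⟩

theorem leaf_cut (hs : IsSpine H b σ) {x : V} (hx : b (σ x) ≠ x) (u v : V) (h : H.Adj u v) :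
    s(u, v) = s(x, b (σ x)) ↔ ¬(u ∈ ({x} : Set V) ↔ v ∈ ({x} : Set V)) := by
  simp only [Set.mem_singleton_iff]
  by_cases hu : u = x
  · subst hu
    have hv := (hs.adj_leaf u hx v).1 h
    subst hv
    simp [hx]
  · by_cases hv : v = x
    · subst hv
      have hu' := (hs.adj_leaf v hx u).1 h.symm
      subst hu'
      simp [hx]
    · simp [hu, hv]

theorem spine_cut (hs : IsSpine H b σ) (i : Fin k) (u v : V) (h : H.Adj u v) :
    s(u, v) = s(b i.castSucc, b i.succ) ↔
      ¬(u ∈ {x | σ x ≤ i.castSucc} ↔ v ∈ {x | σ x ≤ i.castSucc}) := by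
  have hne : ∀ {x}, b (σ x) ≠ x → ∀ j, x ≠ b j := fun hx j hj => hx (by rw [hj, hs.idx])
  simp only [Set.mem_ofPred_eq]
  rcases hs.adj_cases h with ⟨hx, rfl⟩ | ⟨hx, rfl⟩ | ⟨j, ⟨rfl, rfl⟩ | ⟨rfl, rfl⟩⟩
  · simp [hs.idx, hne hx]
  · simp [hs.idx, hne hx]
  · simp only [Sym2.eq_iff, hs.injective.eq_iff, hs.idx, Fin.le_def, Fin.ext_iff, Fin.val_succ,
      Fin.val_castSucc]
    omega
  · simp only [Sym2.eq_iff, hs.injective.eq_iff, hs.idx, Fin.le_def, Fin.ext_iff, Fin.val_succ,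
      Fin.val_castSucc]
    omega

theorem card_le (hs : IsSpine H b σ) (i : Fin (k + 1)) :
    (Finset.univ.filter fun x => σ x ≤ i).card = 3 * (i + 1) := by
  rw [Finset.card_eq_sum_card_fiberwise (f := σ) (t := Finset.Iic i)
    (fun x hx => by simpa using hx)]
  rw [Finset.sum_congr rfl (g := fun _ => 3), Finset.sum_const, Fin.card_Iic, smul_eq_mul, mul_comm]
  intro j hj
  rw [← hs.card_fiber j, Finset.filter_filter]
  congr 1
  ext x
  simp only [Finset.mem_filter, Finset.mem_univ, true_and, and_iff_right_iff_imp]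
  rintro rfl
  exact Finset.mem_Iic.1 hj

theorem card_eq (hs : IsSpine H b σ) : Fintype.card V = 3 * (k + 1) := by
  have := hs.card_le (Fin.last k)
  simpa [Fin.le_last] using this

theorem card_leaves [DecidableEq V] (hs : IsSpine H b σ) :
    (Finset.univ.filter fun x => b (σ x) ≠ x).card = 2 * (k + 1) := by
  have h1 : (Finset.univ.filter fun x => b (σ x) = x) = Finset.univ.image b := by
    ext x
    simp only [Finset.mem_filter, Finset.mem_univ, true_and, Finset.mem_image]
    exact ⟨fun h => ⟨_, h⟩, by rintro ⟨i, rfl⟩; rw [hs.idx]⟩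
  have h2 := Finset.card_filter_add_card_filter_not (s := (Finset.univ : Finset V))
    (fun x => b (σ x) = x)
  rw [h1, Finset.card_image_of_injective _ hs.injective, Finset.card_univ, Finset.card_univ,
    Fintype.card_fin, hs.card_eq] at h2
  simp only [ne_eq]
  omega

/-- This allows the traversal to be taken as starting at `b 0`. -/
theorem reverse (hs : IsSpine H b σ) : IsSpine H (b ∘ Fin.rev) (Fin.rev ∘ σ) where
  idx i := by simp [hs.idx]
  adj_spine i j := by
    simp only [Function.comp_apply, hs.adj_spine, Fin.val_rev]
    omega
  adj_leaf x hx y := by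
    simp only [Function.comp_apply, Fin.rev_rev] at hx ⊢
    exact hs.adj_leaf x hx y
  isLeaf_iff x := by simp [hs.isLeaf_iff]
  card_fiber i := by simp [Fin.rev_eq_iff, hs.card_fiber]

theorem eq_zero_or_last_of_isBackboneEnd (hs : IsSpine H b σ) {r : V} (hr : IsBackboneEnd H r) :
    r = b 0 ∨ r = b (Fin.last k) := by
  obtain ⟨hr1, hr2⟩ := hr
  rw [hs.mem_backbone_iff] at hr1
  by_contra! hcon
  rw [← hr1, hs.injective.ne_iff, hs.injective.ne_iff, Fin.ne_iff_vne, Fin.ne_iff_vne,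
    Fin.val_zero, Fin.val_last] at hcon
  have hlt := (σ r).2
  have hadj : ∀ j : Fin (k + 1), (σ r : ℕ) + 1 = j ∨ (j : ℕ) + 1 = σ r → H.Adj r (b j) :=
    fun j hj => by rwa [← hs.adj_spine, hr1] at hj
  have hsub : ({b ⟨σ r - 1, by omega⟩, b ⟨σ r + 1, by omega⟩} : Set V) ⊆
      {x | H.Adj r x ∧ x ∈ backbone H} := by
    rintro x (rfl | rfl)
    · exact ⟨hadj _ (Or.inr (Nat.sub_add_cancel (by omega))), hs.spine_mem_backbone _⟩
    · exact ⟨hadj _ (Or.inl rfl), hs.spine_mem_backbone _⟩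
  have := Set.ncard_le_ncard hsub (Set.toFinite _)
  rw [Set.ncard_pair (by rw [hs.injective.ne_iff, Fin.ne_iff_vne]; simp only; omega)] at this
  omega

theorem label_lt_label {N : ℕ} (hs : IsSpine H b σ) {label : V ≃ Fin N}
    (hpre : IsPreorderLabelling H (b 0) label)
    (hleaf : ∀ u ∈ backbone H, ∀ y ∈ backbone H, ∀ x, IsLeaf H x →
      H.Adj u x → H.Adj u y → label u < label y → label x < label y)
    {v w : V} (hvw : σ v < σ w) : label v < label w := by
  have hpar : ∀ x, b (σ x) ≠ x → label (b (σ x)) < label x := by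
    intro x hx
    have hx0 : x ≠ b 0 := fun h => hx (by rw [h, hs.idx])
    obtain ⟨p, hp, hlt, -⟩ := hpre.2 x hx0
    rwa [(hs.adj_leaf x hx p).1 hp.symm] at hlt
  -- Induction from the far end: the predecessor of `b i.succ` in the preorder cannot be one of its
  -- leaves (`hpar`), nor the following spine vertex, whose label is larger by induction.
  have hstep : ∀ i : Fin k, label (b i.castSucc) < label (b i.succ) := by
    intro i
    induction hd : k - (i : ℕ) using Nat.strong_induction_on generalizing i with
    | _ d ih =>
      have hne : b i.succ ≠ b 0 := by rw [hs.injective.ne_iff]; exact Fin.succ_ne_zero i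
      obtain ⟨p, hp, hlt, -⟩ := hpre.2 _ hne
      rcases hs.adj_cases hp with ⟨hx, hy⟩ | ⟨hx, -⟩ | ⟨j, ⟨rfl, hj⟩ | ⟨rfl, hj⟩⟩
      · have := hpar p hx
        rw [← hy] at this
        exact absurd hlt this.not_gt
      · rw [hs.idx] at hx
        exact absurd rfl hx
      · rw [hs.injective.eq_iff, Fin.succ_inj] at hj
        subst hj
        exact hlt
      · rw [hs.injective.eq_iff, Fin.ext_iff, Fin.val_succ, Fin.val_castSucc] at hj
        have hlt' := ih (k - j) (by omega) j rfl
        rw [hs.injective.eq_iff.2 (Fin.ext (by simpa using hj) : i.succ = j.castSucc)] at hlt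
        exact absurd hlt hlt'.not_gt
  have hmono : StrictMono fun i => label (b i) := Fin.strictMono_iff_lt_succ.2 hstep
  have hle : ∀ x, label (b (σ x)) ≤ label x := fun x => by
    by_cases hx : b (σ x) = x
    · rw [hx]
    · exact (hpar x hx).le
  have hnext : σ v ≠ Fin.last k := (hvw.trans_le (Fin.le_last _)).ne
  obtain ⟨i, hi⟩ := Fin.exists_castSucc_eq.2 hnext
  have hi' : i.succ ≤ σ w := by
    rw [← hi, Fin.lt_def, Fin.val_castSucc] at hvw
    rw [Fin.le_def, Fin.val_succ]
    exact hvw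
  have hv : label v < label (b i.succ) := by
    by_cases hx : b (σ v) = v
    · rw [← hx, ← hi]
      exact hstep i
    · refine hleaf (b (σ v)) (hs.spine_mem_backbone _) _ (hs.spine_mem_backbone _) v
        ((hs.isLeaf_iff v).2 hx) ((hs.adj_leaf v hx _).2 rfl).symm ?_ ?_
      · rw [← hi]; exact hs.adj_spine_succ i
      · rw [← hi]; exact hstep i
  exact hv.trans_le ((hmono.monotone hi').trans (hle w))

/-- The labels respect the order of the fibres, so the `3 * (i + 1)` vertices with `σ v ≤ i` must
carry the smallest labels. -/
theorem label_lt_iff {N : ℕ} (hs : IsSpine H b σ) {label : V ≃ Fin N}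
    (hlabel : ∀ v w, σ v < σ w → label v < label w) (i : Fin (k + 1)) (v : V) :
    (label v : ℕ) < 3 * (i + 1) ↔ σ v ≤ i := by
  rw [← hs.card_le i]
  constructor
  · intro h
    by_contra! hlt
    have hsub : (Finset.univ.filter fun x => σ x ≤ i).map label.toEmbedding ⊆
        Finset.Iio (label v) := by
      intro y hy
      obtain ⟨x, hx, rfl⟩ := Finset.mem_map.1 hy
      exact Finset.mem_Iio.2 (hlabel _ _ ((Finset.mem_filter.1 hx).2.trans_lt hlt))
    have := Finset.card_le_card hsub
    rw [Finset.card_map, Fin.card_Iio] at this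
    omega
  · intro h
    have hsub : Finset.Iic (label v) ⊆
        (Finset.univ.filter fun x => σ x ≤ i).map label.toEmbedding := by
      intro y hy
      obtain ⟨x, rfl⟩ := label.surjective y
      refine Finset.mem_map.2 ⟨x, Finset.mem_filter.2 ⟨Finset.mem_univ _, ?_⟩, rfl⟩
      exact le_trans (not_lt.1 fun hlt => (hlabel _ _ hlt).not_ge (Finset.mem_Iic.1 hy)) h
    have := Finset.card_le_card hsub
    rw [Finset.card_map, Fin.card_Iic] at this
    omega

theorem exists_caterpillarPreorderLabelling (hs : IsSpine H b σ) :
    ∃ label : V ≃ Fin ((k + 1) * 3), IsCaterpillarPreorderLabelling H label := by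
  classical
  have hfib : ∀ i, ∃ e : {x // σ x = i} ≃ Fin 3, e ⟨b i, hs.idx i⟩ = 0 := by
    intro i
    have hc : Fintype.card {x // σ x = i} = 3 := by
      rw [Fintype.card_subtype, hs.card_fiber]
    let e := Fintype.equivFinOfCardEq hc
    -- The swap puts the spine vertex first in its block of three labels.
    exact ⟨e.trans (Equiv.swap (e ⟨b i, hs.idx i⟩) 0), by simp⟩
  choose e he using hfib
  let label : V ≃ Fin ((k + 1) * 3) :=
    (Equiv.sigmaFiberEquiv σ).symm.trans ((Equiv.sigmaCongrRight e).trans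
      ((Equiv.sigmaEquivProd _ _).trans finProdFinEquiv))
  have hlabel : ∀ x, (label x : ℕ) = e (σ x) ⟨x, rfl⟩ + 3 * σ x := fun x => rfl
  have hspine : ∀ i, (label (b i) : ℕ) = 3 * i := by
    intro i
    rw [hlabel]
    have key : ∀ j (h : σ (b i) = j), (e j ⟨b i, h⟩ : ℕ) + 3 * j = 3 * i := by
      intro j h
      obtain rfl : i = j := (hs.idx i).symm.trans h
      rw [he i]; simp
    exact key _ rfl
  have hbound : ∀ x, 3 * (σ x : ℕ) ≤ label x ∧ (label x : ℕ) < 3 * σ x + 3 := by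
    intro x
    rw [hlabel]
    have := (e (σ x) ⟨x, rfl⟩).2
    omega
  have hlt : ∀ x, b (σ x) ≠ x → label (b (σ x)) < label x := by
    intro x hx
    refine lt_of_le_of_ne ?_ (label.injective.ne hx)
    rw [Fin.le_def, hspine]
    exact (hbound x).1
  -- A vertex labelled strictly between `b i` and `w` is a leaf of `b i`, whose only neighbour is
  -- already visited.
  have hbetween : ∀ (i : Fin (k + 1)) (u w : V), label (b i) < label u → label u < label w →
      (label w : ℕ) ≤ 3 * i + 3 → ∀ x, H.Adj u x → label x < label w := by
    intro i u w h1 h2 h3 x hx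
    have hσ : σ u = i := by
      have := hbound u
      rw [Fin.lt_def] at h1 h2
      rw [hspine] at h1
      exact Fin.ext (by omega)
    have hu : b (σ u) ≠ u := fun h => by
      rw [← hσ, h] at h1
      exact lt_irrefl _ h1
    rw [(hs.adj_leaf u hu x).1 hx, hσ]
    exact h1.trans h2
  refine ⟨label, b 0, ⟨hs.spine_mem_backbone 0, ?_⟩, ⟨by simp [hspine], ?_⟩, ?_⟩
  · rw [Set.ncard_le_one (Set.toFinite _)]
    rintro x ⟨hx, hx'⟩ y ⟨hy, hy'⟩
    rw [hs.mem_backbone_iff] at hx' hy'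
    rw [← hx', hs.adj_spine, Fin.val_zero] at hx
    rw [← hy', hs.adj_spine, Fin.val_zero] at hy
    rw [← hx', ← hy']
    exact congrArg b (Fin.ext (by omega))
  · intro w hw
    by_cases hwl : b (σ w) = w
    · have h0 : σ w ≠ 0 := fun h => hw (by rw [← hwl, h])
      obtain ⟨i, hi⟩ := Fin.exists_succ_eq.2 h0
      have hlw := hspine (σ w)
      rw [hwl, ← hi, Fin.val_succ] at hlw
      have hwi : w = b i.succ := by rw [hi, hwl]
      refine ⟨b i.castSucc, hwi ▸ hs.adj_spine_succ i, ?_, fun u h1 h2 =>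
        hbetween i.castSucc u w h1 h2 ?_⟩
      · rw [Fin.lt_def, hspine, hlw, Fin.val_castSucc]; omega
      · rw [hlw, Fin.val_castSucc]; omega
    · exact ⟨b (σ w), ((hs.adj_leaf w hwl _).2 rfl).symm, hlt w hwl, fun u h1 h2 =>
        hbetween (σ w) u w h1 h2 (hbound w).2.le⟩
  · intro u hu y hy x hx hux huy hlt'
    rw [hs.mem_backbone_iff] at hu hy
    have hx' := (hs.adj_leaf x ((hs.isLeaf_iff x).1 hx) u).1 hux.symm
    have hu2 := hspine (σ u)
    have hy2 := hspine (σ y)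
    have hσ : σ u = σ x := by rw [hx', hs.idx]
    rw [hu] at hu2
    rw [hy] at hy2
    rw [Fin.lt_def] at hlt' ⊢
    have := hbound x
    rw [← hσ] at this
    omega

/-- The wirelength of an embedding into a 2-regular caterpillar as a sum of edge boundaries. -/
theorem wirelength_eq [DecidableEq V] (hs : IsSpine H b σ) {U : Type*} {G : SimpleGraph U}
    (f : GraphEmbedding G H) :
    f.wirelength = ∑ x ∈ Finset.univ.filter (fun x => b (σ x) ≠ x),
      edgeBoundary G (f.toFun ⁻¹' {x}) +
        ∑ i : Fin k, edgeBoundary G (f.toFun ⁻¹' {x | σ x ≤ i.castSucc}) := by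
  classical
  have hne : ∀ {x}, b (σ x) ≠ x → ∀ j, x ≠ b j := fun hx j hj => hx (by rw [hj, hs.idx])
  have hedges : H.edgeFinset =
      ((Finset.univ.filter fun x => b (σ x) ≠ x).image fun x => s(x, b (σ x))) ∪
        (Finset.univ : Finset (Fin k)).image fun i => s(b i.castSucc, b i.succ) := by
    ext d
    induction d using Sym2.ind with
    | _ u v =>
    simp only [SimpleGraph.mem_edgeFinset, SimpleGraph.mem_edgeSet, Finset.mem_union,
      Finset.mem_image, Finset.mem_filter, Finset.mem_univ, true_and]
    constructor
    · intro h
      rcases hs.adj_cases h with ⟨hx, rfl⟩ | ⟨hx, rfl⟩ | ⟨j, ⟨rfl, rfl⟩ | ⟨rfl, rfl⟩⟩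
      · exact Or.inl ⟨u, hx, rfl⟩
      · exact Or.inl ⟨v, hx, Sym2.eq_swap⟩
      · exact Or.inr ⟨j, rfl⟩
      · exact Or.inr ⟨j, Sym2.eq_swap⟩
    · rintro (⟨x, hx, h⟩ | ⟨j, h⟩)
      · rw [← SimpleGraph.mem_edgeSet, ← h, SimpleGraph.mem_edgeSet, hs.adj_leaf x hx]
      · rw [← SimpleGraph.mem_edgeSet, ← h, SimpleGraph.mem_edgeSet]
        exact hs.adj_spine_succ j
  unfold GraphEmbedding.wirelength
  rw [Finset.sum_congr (by convert hedges) fun _ _ => rfl, Finset.sum_union, Finset.sum_image,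
    Finset.sum_image]
  · congr 1
    · exact Finset.sum_congr rfl fun x hx =>
        f.congestion_eq_edgeBoundary (hs.leaf_cut (Finset.mem_filter.1 hx).2)
    · exact Finset.sum_congr rfl fun i _ => f.congestion_eq_edgeBoundary (hs.spine_cut i)
  · intro i _ j _ h
    simp only [Sym2.eq_iff, hs.injective.eq_iff, Fin.ext_iff, Fin.val_succ, Fin.val_castSucc] at h
    exact Fin.ext (by omega)
  · intro x hx y hy h
    have hx' := (Finset.mem_filter.1 (Finset.mem_coe.1 hx)).2
    rcases Sym2.eq_iff.1 h with ⟨h, -⟩ | ⟨h, -⟩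
    · exact h
    · exact absurd h (hne hx' _)
  · rw [Finset.disjoint_left]
    intro d hd hd'
    obtain ⟨x, hx, rfl⟩ := Finset.mem_image.1 hd
    obtain ⟨i, -, h⟩ := Finset.mem_image.1 hd'
    have hx' := (Finset.mem_filter.1 hx).2
    rcases Sym2.eq_iff.1 h with ⟨h, -⟩ | ⟨-, h⟩
    · exact hne hx' _ h.symm
    · exact hne hx' _ h.symm

end IsSpine

/-! ### Optimality of the lexicographic embedding -/

theorem GraphEmbedding.wirelength_ternaryCube {V : Type*} [Fintype V] {H : SimpleGraph V}
    {k N : ℕ} {b : Fin (k + 1) → V} {σ : V → Fin (k + 1)} (hs : IsSpine H b σ)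
    (hcard : Fintype.card V = 3 ^ N) (f : GraphEmbedding (ternaryCube N) H) :
    f.wirelength = 4 * N * (k + 1) +
      ∑ i : Fin k, edgeBoundary (ternaryCube N) (f.toFun ⁻¹' {x | σ x ≤ i.castSucc}) := by
  classical
  have hbij : Function.Bijective f.toFun :=
    (Fintype.bijective_iff_injective_and_card _).2 ⟨f.injective, by simp [hcard]⟩
  rw [hs.wirelength_eq, Finset.sum_congr rfl (g := fun _ => 2 * N), Finset.sum_const,
    hs.card_leaves, smul_eq_mul]
  · congr 1
    ring
  · intro x _
    obtain ⟨y, rfl⟩ := hbij.surjective x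
    rw [← Set.image_singleton, Set.preimage_image_eq _ f.injective, edgeBoundary_singleton]

theorem sum_fin_edgeBoundary_lexSegment {k N : ℕ} (hk : k + 1 = 3 ^ N) :
    4 * (N + 1) * (k + 1) + ∑ i : Fin k,
      edgeBoundary (ternaryCube (N + 1)) ↑(lexSegment (N + 1) (3 * (i + 1))) =
        2 * 3 ^ N * (3 ^ N - 1) + 4 * (N + 1) * 3 ^ N := by
  have h := sum_edgeBoundary_lexSegment N
  rw [← hk, Nat.add_sub_cancel] at h ⊢
  rw [Fin.sum_univ_eq_sum_range fun i =>
    edgeBoundary (ternaryCube (N + 1)) ↑(lexSegment (N + 1) (3 * (i + 1))), h, add_comm]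

/-- The isoperimetric inequality is applied to each backbone edge separately: bijectivity fixes the
size of the preimage of its side. -/
theorem GraphEmbedding.le_wirelength_ternaryCube {V : Type*} [Fintype V] {H : SimpleGraph V}
    {k N : ℕ} {b : Fin (k + 1) → V} {σ : V → Fin (k + 1)} (hs : IsSpine H b σ)
    (hcard : Fintype.card V = 3 ^ (N + 1)) (hk : k + 1 = 3 ^ N)
    (f : GraphEmbedding (ternaryCube (N + 1)) H) :
    2 * 3 ^ N * (3 ^ N - 1) + 4 * (N + 1) * 3 ^ N ≤ f.wirelength := by
  classical
  have hbij : Function.Bijective f.toFun :=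
    (Fintype.bijective_iff_injective_and_card _).2 ⟨f.injective, by simp [hcard]⟩
  rw [f.wirelength_ternaryCube hs hcard, ← sum_fin_edgeBoundary_lexSegment hk]
  refine Nat.add_le_add_left (Finset.sum_le_sum fun i _ => ?_) _
  have h := le_edgeBoundary (Finset.univ.filter fun x => σ (f.toFun x) ≤ i.castSucc)
  rw [Finset.card_equiv (Equiv.ofBijective _ hbij)
    (t := Finset.univ.filter fun v => σ v ≤ i.castSucc) (by simp), hs.card_le] at h
  simpa using h

theorem GraphEmbedding.wirelength_lex {V : Type*} [Fintype V] {H : SimpleGraph V}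
    {k N : ℕ} {b : Fin (k + 1) → V} {σ : V → Fin (k + 1)} (hs : IsSpine H b σ)
    (hcard : Fintype.card V = 3 ^ (N + 1)) (hk : k + 1 = 3 ^ N) {label : V ≃ Fin (3 ^ (N + 1))}
    (hlabel : ∀ v w, σ v < σ w → label v < label w) (f : GraphEmbedding (ternaryCube (N + 1)) H)
    (hf : ∀ x, (label (f.toFun x) : ℕ) = lexLabel x) :
    f.wirelength = 2 * 3 ^ N * (3 ^ N - 1) + 4 * (N + 1) * 3 ^ N := by
  rw [f.wirelength_ternaryCube hs hcard, ← sum_fin_edgeBoundary_lexSegment hk]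
  congr 1
  refine Finset.sum_congr rfl fun i _ => congrArg _ ?_
  ext x
  simp only [Set.mem_preimage, Set.mem_ofPred_eq, lexSegment, Finset.coe_filter, Finset.mem_univ,
    true_and]
  rw [← hs.label_lt_iff hlabel, hf, lexLabel_eq, Fin.val_castSucc]

theorem IsSpine.exists_label_mono {V : Type*} [Fintype V] {H : SimpleGraph V}
    {k N : ℕ} {b : Fin (k + 1) → V} {σ : V → Fin (k + 1)} (hs : IsSpine H b σ)
    {label : V ≃ Fin N} (hlabel : IsCaterpillarPreorderLabelling H label) :
    ∃ (b' : Fin (k + 1) → V) (σ' : V → Fin (k + 1)), IsSpine H b' σ' ∧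
      ∀ v w, σ' v < σ' w → label v < label w := by
  obtain ⟨r, hr, hpre, hleaf⟩ := hlabel
  rcases hs.eq_zero_or_last_of_isBackboneEnd hr with rfl | rfl
  · exact ⟨b, σ, hs, fun v w => hs.label_lt_label hpre hleaf⟩
  · refine ⟨_, _, hs.reverse, fun v w => hs.reverse.label_lt_label ?_ hleaf⟩
    simpa using hpre

theorem theorem5p4 {V : Type*} [Fintype V] (n : ℕ) (hn : 1 ≤ n) (H : SimpleGraph V)
    (hH : IsRegularCaterpillar 2 H) (hcard : Fintype.card V = 3 ^ n) :
    -- the caterpillar has a preorder labelling, and for every one of them ...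
    (∃ label : V ≃ Fin (3 ^ n), IsCaterpillarPreorderLabelling H label) ∧
    (∀ label : V ≃ Fin (3 ^ n), IsCaterpillarPreorderLabelling H label →
      -- ... the embedding that matches it with the lexicographic labels exists and is optimal
      (∃ f : GraphEmbedding (ternaryCube n) H, ∀ x, (label (f.toFun x) : ℕ) = lexLabel x) ∧
      ∀ f : GraphEmbedding (ternaryCube n) H, (∀ x, (label (f.toFun x) : ℕ) = lexLabel x) →
        f.wirelength = minWirelength (ternaryCube n) H) ∧
    minWirelength (ternaryCube n) H =
      2 * 3 ^ (n - 1) * (3 ^ (n - 1) - 1) + 4 * n * 3 ^ (n - 1) := by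
  obtain ⟨N, rfl⟩ := Nat.exists_eq_add_of_le' hn
  rw [Nat.add_sub_cancel]
  have h3 : 3 ≤ Fintype.card V := by
    rw [hcard, pow_succ]
    have := Nat.one_le_pow N 3 (by norm_num)
    omega
  obtain ⟨k, b, σ, hs⟩ := hH.exists_isSpine h3
  have hk : k + 1 = 3 ^ N := by
    have := hs.card_eq
    rw [hcard, pow_succ] at this
    omega
  have hex : ∃ label : V ≃ Fin (3 ^ (N + 1)), IsCaterpillarPreorderLabelling H label := by
    have := hs.exists_caterpillarPreorderLabelling
    rwa [hk, ← pow_succ] at this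
  have hlex : ∀ label : V ≃ Fin (3 ^ (N + 1)), ∃ f : GraphEmbedding (ternaryCube (N + 1)) H,
      ∀ x, (label (f.toFun x) : ℕ) = lexLabel x := by
    intro label
    obtain ⟨f, hf⟩ := hH.1.1.exists_graphEmbedding (ternaryCube (N + 1))
      (fun x => label.symm (finFunctionFinEquiv x))
      (label.symm.injective.comp finFunctionFinEquiv.injective)
    exact ⟨f, fun x => by rw [hf, label.apply_symm_apply, lexLabel_eq]⟩
  have hval : ∀ label : V ≃ Fin (3 ^ (N + 1)), IsCaterpillarPreorderLabelling H label →
      ∀ f : GraphEmbedding (ternaryCube (N + 1)) H,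
        (∀ x, (label (f.toFun x) : ℕ) = lexLabel x) →
        f.wirelength = 2 * 3 ^ N * (3 ^ N - 1) + 4 * (N + 1) * 3 ^ N := by
    intro label hlabel f hf
    obtain ⟨b', σ', hs', hmono⟩ := hs.exists_label_mono hlabel
    exact f.wirelength_lex hs' hcard hk hmono hf
  have hmin : minWirelength (ternaryCube (N + 1)) H =
      2 * 3 ^ N * (3 ^ N - 1) + 4 * (N + 1) * 3 ^ N := by
    obtain ⟨label, hlabel⟩ := hex
    obtain ⟨f, hf⟩ := hlex label
    -- The infimum of the empty set would be 0; the lexicographic embedding shows that the range is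
    -- nonempty.
    refine le_antisymm ?_ (le_csInf ⟨_, f, rfl⟩ ?_)
    · rw [← hval label hlabel f hf]
      exact Nat.sInf_le ⟨f, rfl⟩
    · rintro _ ⟨g, rfl⟩
      exact g.le_wirelength_ternaryCube hs hcard hk
  exact ⟨hex, fun label hlabel => ⟨hlex label, fun f hf => by rw [hval label hlabel f hf, hmin]⟩,
    hmin⟩
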